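/- Let $n\ge 0$ and let $H_n=(\mathbb{C}^2)^{\otimes n}$ be the Hilbert space of an $n$-qubit register, with orthonormal computational basis $|b_1\cdots b_n\rangle$, $b_i\in\{0,1\}$. A pure state is a class $[\psi]$ of unit vectors $\psi\in H_n$ modulo multiplication by a phase $e^{i\phi}$; the set $\mathcal{P}_n$ of pure states carries the quotient topology of the unit sphere of $H_n$. A product state is a pure state of the form $[c_1\otimes\cdots\otimes c_n]$ with unit vectors $c_i\in\mathbb{C}^2$. Then: 1. $\mathcal{P}_n$ is a second countable Hausdorff space and has the structure of a smooth real manifold of dimension $2^{n+1}-2$, for which the map sending $[\psi]$ to the point of the complex projective space $\mathbb{CP}^{2^n-1}$ whose homogeneous coordinates are the $2^n$ amplitudes of $\psi$ is a diffeomorphism, where $\mathbb{CP}^{2^n-1}$ carries its standard smooth structure (given by the affine charts). 2. The set of product states, with the subspace topology, has the structure of a smooth real manifold of dimension $2n$, for which its inclusion into $\mathcal{P}_n$ is a smooth embedding. -/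

import Mathlib

open scoped Manifold ContDiff LinearAlgebra.Projectivization TensorProduct

noncomputable section

namespace QubitRegister

/-! ### The Hilbert space of an `n`-qubit register -/

/-- The state space `ℂ²` of one qubit, with its standard basis indexed by `{0, 1}`. -/
abbrev Qubit : Type := EuclideanSpace ℂ (Fin 2)

/-- The Hilbert space `H_n` of an `n`-qubit register: a vector is the family of its amplitudes
`z_{b_1 … b_n}` in the computational basis `|b_1 … b_n⟩`, and the inner product is the
standard one. It is identified with `(ℂ²)^{⊗ n}` by `tensorEquiv`. -/
abbrev Register (n : ℕ) : Type := EuclideanSpace ℂ (Fin n → Fin 2)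

/-- The identification `(ℂ²)^{⊗ n} ≃ H_n` that sends the basis tensor `|b_1⟩ ⊗ ⋯ ⊗ |b_n⟩` to the
computational basis vector `|b_1 … b_n⟩`. -/
def tensorEquiv (n : ℕ) : (⨂[ℂ] _ : Fin n, Qubit) ≃ₗ[ℂ] Register n :=
  (Basis.piTensorProduct fun _ : Fin n => (EuclideanSpace.basisFun (Fin 2) ℂ).toBasis).equivFun ≪≫ₗ
    (WithLp.linearEquiv 2 ℂ ((Fin n → Fin 2) → ℂ)).symm

/-- The vector `c_1 ⊗ ⋯ ⊗ c_n` of `H_n`. -/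
def tensorVec {n : ℕ} (c : Fin n → Qubit) : Register n :=
  tensorEquiv n (PiTensorProduct.tprod ℂ c)

theorem tensorVec_apply {n : ℕ} (c : Fin n → Qubit) (b : Fin n → Fin 2) :
    tensorVec c b = ∏ i, c i (b i) := by
  simp [tensorVec, tensorEquiv]

/-! ### Pure states and product states -/

/-- The normalized vectors of `H_n`. -/
abbrev UnitVec (n : ℕ) : Type := Metric.sphere (0 : Register n) 1

/-- Two normalized vectors describe the same state iff they differ by a phase factor. -/
def phaseSetoid (n : ℕ) : Setoid (UnitVec n) where
  r ψ φ := ∃ u : Circle, (ψ : Register n) = (u : ℂ) • (φ : Register n)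
  iseqv :=
    { refl := fun ψ => ⟨1, by simp⟩
      symm := by
        rintro ψ φ ⟨u, h⟩
        exact ⟨u⁻¹, by rw [h, smul_smul, ← Circle.coe_mul]; simp⟩
      trans := by
        rintro ψ φ χ ⟨u, h⟩ ⟨v, k⟩
        exact ⟨u * v, by rw [h, k, smul_smul, Circle.coe_mul]⟩ }

/-- The pure states of an `n`-qubit register: normalized vectors modulo a global phase. -/
def PureState (n : ℕ) : Type := Quotient (phaseSetoid n)

/-- The pure state described by a normalized vector. -/
def PureState.mk {n : ℕ} (ψ : UnitVec n) : PureState n := Quotient.mk (phaseSetoid n) ψ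

/-- The quotient topology of the norm topology on the unit sphere. -/
instance (n : ℕ) : TopologicalSpace (PureState n) :=
  inferInstanceAs (TopologicalSpace (Quotient (phaseSetoid n)))

/-- The product states: those described by `c_1 ⊗ ⋯ ⊗ c_n` with normalized `c_i ∈ ℂ²`. As a
subset of `PureState n` it carries the subspace topology. -/
def productStates (n : ℕ) : Set (PureState n) :=
  {p | ∃ (c : Fin n → Qubit) (ψ : UnitVec n),
    (∀ i, ‖c i‖ = 1) ∧ (ψ : Register n) = tensorVec c ∧ p = PureState.mk ψ}

/-! ### Complex projective space as a real manifold -/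

/-- Complex projective space `ℂP^N`: the lines through the origin in `ℂ^{N+1}`. -/
abbrev CP (N : ℕ) : Type := ℙ ℂ (EuclideanSpace ℂ (Fin (N + 1)))

/-- The quotient topology of `ℂ^{N+1} ∖ {0}`. -/
instance (N : ℕ) : TopologicalSpace (CP N) :=
  inferInstanceAs (TopologicalSpace
    (Quotient (projectivizationSetoid ℂ (EuclideanSpace ℂ (Fin (N + 1))))))

namespace CP

variable {N : ℕ}

theorem isOpenQuotientMap_mk' :
    IsOpenQuotientMap (Projectivization.mk' ℂ :
      {v : EuclideanSpace ℂ (Fin (N + 1)) // v ≠ 0} → CP N) := by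
  refine ⟨Quotient.mk_surjective, continuous_quotient_mk', fun U hU => ?_⟩
  refine isOpen_coinduced.2 ?_
  have h : (Quotient.mk (projectivizationSetoid ℂ (EuclideanSpace ℂ (Fin (N + 1))))) ⁻¹'
      (Projectivization.mk' ℂ '' U) =
      ⋃ a : ℂˣ, (fun v : {v : EuclideanSpace ℂ (Fin (N + 1)) // v ≠ 0} =>
        (⟨a • v.1, (smul_ne_zero_iff_ne a).2 v.2⟩ :
          {v : EuclideanSpace ℂ (Fin (N + 1)) // v ≠ 0})) ⁻¹' U := by
    ext v
    simp only [Set.mem_preimage, Set.mem_iUnion]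
    constructor
    · rintro ⟨w, hw, hwv⟩
      obtain ⟨a, ha⟩ := (Projectivization.mk_eq_mk_iff ℂ w.1 v.1 w.2 v.2).1 hwv
      exact ⟨a, by simpa only [ha] using hw⟩
    · rintro ⟨a, ha⟩
      exact ⟨_, ha, (Projectivization.mk_eq_mk_iff ℂ _ v.1 _ v.2).2 ⟨a, rfl⟩⟩
  refine h ▸ isOpen_iUnion fun a => hU.preimage ?_
  exact Continuous.subtype_mk (continuous_subtype_val.const_smul a) _

/-- The set `{[z_0 : ⋯ : z_N] | z_i ≠ 0}`. -/
def affineSource (i : Fin (N + 1)) : Set (CP N) :=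
  {p | Projectivization.lift
    (fun v : {v : EuclideanSpace ℂ (Fin (N + 1)) // v ≠ 0} => v.1 i ≠ 0) (by
    rintro ⟨a, ha⟩ ⟨b, hb⟩ t (rfl : a = t • b)
    have ht : t ≠ 0 := fun h => ha (by simp [h])
    simp [ht]) p}

/-- The affine coordinates `[z_0 : ⋯ : z_N] ↦ (z_j / z_i)_{j ≠ i}`. -/
def affineCoord (i : Fin (N + 1)) : CP N → EuclideanSpace ℂ (Fin N) :=
  Projectivization.lift (fun v : {v : EuclideanSpace ℂ (Fin (N + 1)) // v ≠ 0} =>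
    WithLp.toLp 2 fun k => v.1 (i.succAbove k) / v.1 i) (by
    rintro ⟨a, ha⟩ ⟨b, hb⟩ t (rfl : a = t • b)
    have ht : t ≠ 0 := fun h => ha (by simp [h])
    ext k
    simp [mul_div_mul_left _ _ ht])

/-- The vector of `ℂ^{N+1}` with `i`-th coordinate `1` and the other coordinates given by `w`. -/
def affineLift (i : Fin (N + 1)) (w : EuclideanSpace ℂ (Fin N)) :
    EuclideanSpace ℂ (Fin (N + 1)) :=
  WithLp.toLp 2 (i.insertNth 1 fun k => w k)

@[simp]
theorem affineLift_self (i : Fin (N + 1)) (w : EuclideanSpace ℂ (Fin N)) :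
    affineLift i w i = 1 := by
  simp [affineLift]

@[simp]
theorem affineLift_succAbove (i : Fin (N + 1)) (w : EuclideanSpace ℂ (Fin N)) (k : Fin N) :
    affineLift i w (i.succAbove k) = w k := by
  simp [affineLift]

theorem affineLift_ne_zero (i : Fin (N + 1)) (w : EuclideanSpace ℂ (Fin N)) :
    affineLift i w ≠ 0 := fun h => by
  have := affineLift_self i w
  simp [h] at this

theorem contDiff_affineLift (i : Fin (N + 1)) : ContDiff ℝ ∞ (affineLift (N := N) i) := by
  refine (contDiff_piLp 2).2 ?_
  intro j
  rcases Fin.eq_self_or_eq_succAbove i j with rfl | ⟨k, rfl⟩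
  · simpa using contDiff_const
  · simp only [affineLift_succAbove]
    fun_prop

/-- The standard affine chart of `ℂP^N` on `{z_i ≠ 0}`. -/
def affineChart (i : Fin (N + 1)) : OpenPartialHomeomorph (CP N) (EuclideanSpace ℂ (Fin N)) where
  toFun := affineCoord i
  invFun w := Projectivization.mk ℂ (affineLift i w) (affineLift_ne_zero i w)
  source := affineSource i
  target := Set.univ
  map_source' _ _ := Set.mem_univ _
  map_target' w _ := by
    change affineLift i w i ≠ 0
    simp
  left_inv' p hp := by
    induction p using Projectivization.ind with
    | h v hv =>
      have hi : v i ≠ 0 := hp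
      refine (Projectivization.mk_eq_mk_iff' ℂ _ _ _ _).2 ⟨(v i)⁻¹, ?_⟩
      ext j
      rcases Fin.eq_self_or_eq_succAbove i j with rfl | ⟨k, rfl⟩
      · simp [hi]
      · simp [affineCoord, div_eq_inv_mul]
  right_inv' w _ := by
    ext k
    simp [affineCoord]
  open_source := isOpenQuotientMap_mk'.isQuotientMap.isOpen_preimage.1 <|
    isOpen_ne_fun
      (f := fun v : {v : EuclideanSpace ℂ (Fin (N + 1)) // v ≠ 0} => v.1 i) (g := fun _ => 0)
      (by fun_prop) continuous_const
  open_target := isOpen_univ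
  continuousOn_toFun := by
    refine (isOpenQuotientMap_mk'.isQuotientMap.continuousOn_isOpen_iff ?_).2 ?_
    · exact isOpenQuotientMap_mk'.isQuotientMap.isOpen_preimage.1 <|
        isOpen_ne_fun
          (f := fun v : {v : EuclideanSpace ℂ (Fin (N + 1)) // v ≠ 0} => v.1 i) (g := fun _ => 0)
          (by fun_prop) continuous_const
    · refine (PiLp.continuous_toLp 2 _).comp_continuousOn (continuousOn_pi.2 fun k => ?_)
      exact ContinuousOn.div (by fun_prop) (by fun_prop) fun v hv => hv
  continuousOn_invFun := by
    refine Continuous.continuousOn ?_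
    exact isOpenQuotientMap_mk'.continuous.comp
      (Continuous.subtype_mk (contDiff_affineLift i).continuous (affineLift_ne_zero i))

theorem exists_mem_affineSource (p : CP N) : ∃ i, p ∈ affineSource i := by
  induction p using Projectivization.ind with
  | h v hv =>
    by_contra! h
    exact hv (by ext i; exact not_not.1 (h i))

/-- The standard atlas of `ℂP^N`, formed by the `N + 1` affine charts. -/
instance : ChartedSpace (EuclideanSpace ℂ (Fin N)) (CP N) where
  atlas := Set.range affineChart
  chartAt p := affineChart (exists_mem_affineSource p).choose
  mem_chart_source p := (exists_mem_affineSource p).choose_spec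
  chart_mem_atlas _ := Set.mem_range_self _

/-- With its affine charts, `ℂP^N` is a smooth real manifold modelled on the real vector space
underlying `ℂ^N`. -/
instance : IsManifold 𝓘(ℝ, EuclideanSpace ℂ (Fin N)) ∞ (CP N) := by
  refine isManifold_of_contDiffOn _ _ _ ?_
  rintro _ _ ⟨i, rfl⟩ ⟨j, rfl⟩
  simp only [modelWithCornersSelf_coe, modelWithCornersSelf_coe_symm, Function.id_comp,
    Function.comp_id, Set.range_id, Set.inter_univ, Set.preimage_id]
  intro w hw
  have hj : affineLift i w j ≠ 0 := hw.2
  refine ContDiffAt.contDiffWithinAt ?_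
  refine (contDiffAt_piLp 2).2 fun k => ?_
  change ContDiffAt ℝ ∞ (fun w => affineLift i w (j.succAbove k) / affineLift i w j) w
  have h := fun l => ((contDiff_piLp 2).1 (contDiff_affineLift (N := N) i) l).contDiffAt (x := w)
  exact (h _).mul ((contDiffAt_inv ℝ hj).comp w (h _))

end CP

/-! ### The comparison map -/

/-- The enumeration `b ↦ ∑ᵢ bᵢ 2^i` of the computational basis by the binary number that
a bit string represents. -/
def basisEnum (n : ℕ) : (Fin n → Fin 2) ≃ Fin (2 ^ n - 1 + 1) :=
  finFunctionFinEquiv.trans (finCongr (Nat.sub_add_cancel Nat.one_le_two_pow).symm)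

/-- The amplitudes of a vector of `H_n`, listed as a vector of `ℂ^{2^n}` in the order
of `basisEnum`. -/
def amplitudes (n : ℕ) : Register n ≃ₗᵢ[ℂ] EuclideanSpace ℂ (Fin (2 ^ n - 1 + 1)) :=
  LinearIsometryEquiv.piLpCongrLeft 2 ℂ ℂ (basisEnum n)

theorem amplitudes_apply (n : ℕ) (ψ : Register n) (k : Fin (2 ^ n - 1 + 1)) :
    amplitudes n ψ k = ψ ((basisEnum n).symm k) := rfl

theorem amplitudes_ne_zero {n : ℕ} (ψ : UnitVec n) : amplitudes n ψ ≠ 0 := by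
  rw [Ne, map_eq_zero_iff _ (amplitudes n).injective]
  exact ne_zero_of_mem_unit_sphere ψ

/-- The point of `ℂP^{2^n - 1}` whose homogeneous coordinates are the amplitudes of `ψ`. -/
def toCP {n : ℕ} (ψ : UnitVec n) : CP (2 ^ n - 1) :=
  Projectivization.mk ℂ (amplitudes n ψ) (amplitudes_ne_zero ψ)

end QubitRegister

end

/-! Every complex line contains a unit vector, unique up to a phase, so `toCP` descends to a
continuous bijection from pure states to projective space, with normalization as its continuous
inverse. The smooth structure is pulled back along this homeomorphism (`pureStateHomeomorph`), which
makes it a diffeomorphism. Hausdorffness comes from the continuous injection of states into density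
matrices, second countability from compactness and the charts.

For product states, fix a bit string `b` and work where the amplitude at `b` is nonzero. A product
is determined there by the `n` ratios of amplitudes at the one-bit flips of `b`, and every other
ratio is a product of these (`mk_mem_productStates_iff`). So in the affine chart the product states
are the image of the polynomial map `segre`, a section of the linear projection `flipCoords`. Such
an image is a graph, and a shear flattens it to a coordinate subspace
(`exists_homeomorph_snd_eq_zero_iff`). The resulting slice charts give the embedded submanifold
(`exists_chartedSpace_of_isSliceChart`). -/

namespace Manifold

/-! ### Transport of a smooth structure along a homeomorphism -/

section Transport

variable {𝕜 E E' M N : Type*} [NontriviallyNormedField 𝕜]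
  [NormedAddCommGroup E] [NormedSpace 𝕜 E] [NormedAddCommGroup E'] [NormedSpace 𝕜 E']
  [TopologicalSpace M] [TopologicalSpace N] {n : ℕ∞ω}

/-- The chart of `M` obtained from a chart of `N` through a homeomorphism `M ≃ₜ N` and a
homeomorphism of the model spaces. -/
def transportChart (h : M ≃ₜ N) (L : E ≃ₜ E') (e : OpenPartialHomeomorph N E) :
    OpenPartialHomeomorph M E' :=
  (h.toOpenPartialHomeomorph.trans e).trans L.toOpenPartialHomeomorph

@[simp]
theorem transportChart_apply (h : M ≃ₜ N) (L : E ≃ₜ E') (e : OpenPartialHomeomorph N E) (x : M) :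
    transportChart h L e x = L (e (h x)) := rfl

@[simp]
theorem transportChart_symm_apply (h : M ≃ₜ N) (L : E ≃ₜ E') (e : OpenPartialHomeomorph N E)
    (y : E') : (transportChart h L e).symm y = h.symm (e.symm (L.symm y)) := rfl

@[simp]
theorem transportChart_source (h : M ≃ₜ N) (L : E ≃ₜ E') (e : OpenPartialHomeomorph N E) :
    (transportChart h L e).source = h ⁻¹' e.source := by
  simp [transportChart]

@[simp]
theorem transportChart_target (h : M ≃ₜ N) (L : E ≃ₜ E') (e : OpenPartialHomeomorph N E) :
    (transportChart h L e).target = L.symm ⁻¹' e.target := by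
  ext
  simp [transportChart]

variable [ChartedSpace E N]

/-- The charted space structure pulled back along a homeomorphism, with the model space
replaced by a homeomorphic one. -/
@[reducible]
def transportChartedSpace (h : M ≃ₜ N) (L : E ≃ₜ E') : ChartedSpace E' M where
  atlas := transportChart h L '' atlas E N
  chartAt x := transportChart h L (chartAt E (h x))
  mem_chart_source x := by simp
  chart_mem_atlas x := ⟨_, chart_mem_atlas E (h x), rfl⟩

/-- The homeomorphism `h` cancels in a change of charts, leaving the old transition map conjugated
by `L`. -/
theorem isManifold_transportChartedSpace [IsManifold 𝓘(𝕜, E) n N] (h : M ≃ₜ N) (L : E ≃L[𝕜] E') :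
    letI := transportChartedSpace h L.toHomeomorph
    IsManifold 𝓘(𝕜, E') n M := by
  let := transportChartedSpace h L.toHomeomorph
  refine isManifold_of_contDiffOn _ _ _ ?_
  rintro _ _ ⟨e, he, rfl⟩ ⟨e', he', rfl⟩
  have key := (contMDiffOn_iff_contDiffOn.1 <| contMDiffOn_of_mem_contDiffGroupoid
    (StructureGroupoid.compatible (contDiffGroupoid n 𝓘(𝕜, E)) he he'))
  simp only [modelWithCornersSelf_coe, modelWithCornersSelf_coe_symm, Function.id_comp,
    Function.comp_id, Set.range_id, Set.inter_univ, Set.preimage_id] at key ⊢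
  refine (L.contDiff.comp_contDiffOn (key.comp L.symm.contDiff.contDiffOn ?_)).congr ?_
  · intro y hy
    simpa using hy
  · intro y hy
    simp

/-- Read in corresponding charts, `h` is the linear map `L.symm`. -/
theorem contMDiff_transportChartedSpace [IsManifold 𝓘(𝕜, E) n N] (h : M ≃ₜ N) (L : E ≃L[𝕜] E') :
    letI := transportChartedSpace h L.toHomeomorph
    ContMDiff 𝓘(𝕜, E') 𝓘(𝕜, E) n h := by
  let := transportChartedSpace h L.toHomeomorph
  have : IsManifold 𝓘(𝕜, E') n M := isManifold_transportChartedSpace (n := n) h L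
  intro x
  have h1 := contMDiffAt_of_mem_maximalAtlas (I := 𝓘(𝕜, E')) (n := n)
    (IsManifold.chart_mem_maximalAtlas x) (mem_chart_source E' x)
  have h2 := contMDiffAt_symm_of_mem_maximalAtlas (I := 𝓘(𝕜, E)) (n := n)
    (IsManifold.chart_mem_maximalAtlas (h x)) (mem_chart_target E (h x))
  have h3 : ContMDiffAt 𝓘(𝕜, E') 𝓘(𝕜, E) n L.symm (chartAt E' x x) :=
    L.symm.contDiff.contMDiff.contMDiffAt
  have hx : L.symm (chartAt E' x x) = chartAt E (h x) (h x) := L.symm_apply_apply _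
  rw [← hx] at h2
  refine ((h2.comp _ h3).comp x h1).congr_of_eventuallyEq ?_
  filter_upwards [(chartAt E' x).open_source.mem_nhds (mem_chart_source E' x)] with y hy
  have hy' : h y ∈ (chartAt E (h x)).source := by
    change y ∈ (transportChart h L.toHomeomorph _).source at hy
    simpa using hy
  change h y = (chartAt E (h x)).symm (L.symm (L (chartAt E (h x) (h y))))
  rw [L.symm_apply_apply, OpenPartialHomeomorph.left_inv _ hy']

theorem contMDiff_symm_transportChartedSpace [IsManifold 𝓘(𝕜, E) n N] (h : M ≃ₜ N)
    (L : E ≃L[𝕜] E') :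
    letI := transportChartedSpace h L.toHomeomorph
    ContMDiff 𝓘(𝕜, E) 𝓘(𝕜, E') n h.symm := by
  let := transportChartedSpace h L.toHomeomorph
  have : IsManifold 𝓘(𝕜, E') n M := isManifold_transportChartedSpace (n := n) h L
  intro q
  obtain ⟨x, rfl⟩ := h.surjective q
  have h1 := contMDiffAt_of_mem_maximalAtlas (I := 𝓘(𝕜, E)) (n := n)
    (IsManifold.chart_mem_maximalAtlas (h x)) (mem_chart_source E (h x))
  have h2 := contMDiffAt_symm_of_mem_maximalAtlas (I := 𝓘(𝕜, E')) (n := n)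
    (IsManifold.chart_mem_maximalAtlas x) (mem_chart_target E' x)
  have h3 : ContMDiffAt 𝓘(𝕜, E) 𝓘(𝕜, E') n L (chartAt E (h x) (h x)) :=
    L.contDiff.contMDiff.contMDiffAt
  have hx : chartAt E' x x = L (chartAt E (h x) (h x)) := rfl
  rw [hx] at h2
  refine ((h2.comp _ h3).comp _ h1).congr_of_eventuallyEq ?_
  filter_upwards [(chartAt E (h x)).open_source.mem_nhds (mem_chart_source E (h x))] with y hy
  change h.symm y = h.symm ((chartAt E (h x)).symm (L.symm (L (chartAt E (h x) y))))
  rw [L.symm_apply_apply, OpenPartialHomeomorph.left_inv _ hy]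

/-- A chart of the transported structure may be composed with any diffeomorphism of the
model spaces. -/
theorem transportChart_mem_maximalAtlas [IsManifold 𝓘(𝕜, E) n N] (h : M ≃ₜ N) (L : E ≃L[𝕜] E')
    {e : OpenPartialHomeomorph N E} (he : e ∈ IsManifold.maximalAtlas 𝓘(𝕜, E) n N)
    (D : E ≃ₜ E') (hD : ContDiff 𝕜 n D) (hD' : ContDiff 𝕜 n D.symm) :
    letI := transportChartedSpace h L.toHomeomorph
    transportChart h D e ∈ IsManifold.maximalAtlas 𝓘(𝕜, E') n M := by
  let := transportChartedSpace h L.toHomeomorph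
  have : IsManifold 𝓘(𝕜, E') n M := isManifold_transportChartedSpace (n := n) h L
  refine (IsManifold.mem_maximalAtlas_iff_contMDiffOn _).2 ⟨?_, ?_⟩
  · refine hD.contMDiff.comp_contMDiffOn ((contMDiffOn_of_mem_maximalAtlas he).comp
      (contMDiff_transportChartedSpace h L).contMDiffOn ?_)
    intro x hx
    simpa using hx
  · refine (contMDiff_symm_transportChartedSpace h L).comp_contMDiffOn
      ((contMDiffOn_symm_of_mem_maximalAtlas he).comp hD'.contMDiff.contMDiffOn ?_)
    intro x hx
    simpa using hx

end Transport

/-! ### Slice charts and embedded submanifolds -/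

section Slice

universe u

variable {𝕜 E F M : Type*} {E' : Type u} [NontriviallyNormedField 𝕜]
  [NormedAddCommGroup E] [NormedSpace 𝕜 E] [NormedAddCommGroup F] [NormedSpace 𝕜 F]
  [NormedAddCommGroup E'] [NormedSpace 𝕜 E'] [TopologicalSpace M] {n : ℕ∞ω}

/-- A chart `φ` of `M` onto the whole model space `E' ≃ E × F` in which `S` is the slice
`E × {0}`. -/
structure IsSliceChart (K : (E × F) ≃L[𝕜] E') (S : Set M) (φ : OpenPartialHomeomorph M E') :
    Prop where
  target_eq : φ.target = Set.univ
  mem_iff : ∀ y ∈ φ.source, y ∈ S ↔ (K.symm (φ y)).2 = 0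

namespace IsSliceChart

variable {K : (E × F) ≃L[𝕜] E'} {S : Set M} {φ : OpenPartialHomeomorph M E'}

theorem symm_mem_source (h : IsSliceChart K S φ) (y : E') : φ.symm y ∈ φ.source :=
  φ.map_target (h.target_eq ▸ Set.mem_univ y)

theorem apply_symm (h : IsSliceChart K S φ) (y : E') : φ (φ.symm y) = y :=
  φ.right_inv (h.target_eq ▸ Set.mem_univ y)

theorem symm_mem (h : IsSliceChart K S φ) (v : E) : φ.symm (K (v, 0)) ∈ S := by
  rw [h.mem_iff _ (h.symm_mem_source _), h.apply_symm, K.symm_apply_apply]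

theorem apply_eq (h : IsSliceChart K S φ) {y : M} (hy : y ∈ φ.source) (hS : y ∈ S) :
    K ((K.symm (φ y)).1, 0) = φ y := by
  have h2 := (h.mem_iff y hy).1 hS
  rw [← h2, Prod.mk.eta, K.apply_symm_apply]

/-- The chart that a slice chart induces on the slice. -/
def chart (h : IsSliceChart K S φ) : OpenPartialHomeomorph S E where
  toFun y := (K.symm (φ y)).1
  invFun v := ⟨φ.symm (K (v, 0)), h.symm_mem v⟩
  source := Subtype.val ⁻¹' φ.source
  target := Set.univ
  map_source' _ _ := Set.mem_univ _
  map_target' _ _ := h.symm_mem_source _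
  left_inv' y hy := by
    ext
    simp only [h.apply_eq hy y.2, φ.left_inv hy]
  right_inv' v _ := by simp only [h.apply_symm, K.symm_apply_apply]
  open_source := φ.open_source.preimage continuous_subtype_val
  open_target := isOpen_univ
  continuousOn_toFun :=
    (continuous_fst.comp K.symm.continuous).comp_continuousOn
      (φ.continuousOn.comp continuous_subtype_val.continuousOn fun _ hy => hy)
  continuousOn_invFun := by
    refine (Continuous.subtype_mk ?_ _).continuousOn
    have hc : Continuous φ.symm := by
      have := φ.symm.continuousOn
      rwa [OpenPartialHomeomorph.symm_source, h.target_eq, continuousOn_univ] at this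
    exact hc.comp (K.continuous.comp (by fun_prop))

end IsSliceChart

/-- A subset that is covered by slice charts is an embedded submanifold. -/
theorem exists_chartedSpace_of_isSliceChart [ChartedSpace E' M] [IsManifold 𝓘(𝕜, E') n M]
    (K : (E × F) ≃L[𝕜] E') (S : Set M)
    (hS : ∀ x ∈ S, ∃ φ ∈ IsManifold.maximalAtlas 𝓘(𝕜, E') n M,
      x ∈ φ.source ∧ IsSliceChart K S φ) :
    ∃ _ : ChartedSpace E S, IsManifold 𝓘(𝕜, E) n S ∧
      IsSmoothEmbedding 𝓘(𝕜, E) 𝓘(𝕜, E') n (Subtype.val : S → M) := by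
  choose φ hφ hx h using hS
  let cs : ChartedSpace E S :=
    { atlas := Set.range fun x : S => (h x x.2).chart
      chartAt x := (h x x.2).chart
      mem_chart_source x := hx x x.2
      chart_mem_atlas x := Set.mem_range_self x }
  have hM : IsManifold 𝓘(𝕜, E) n S := by
    refine isManifold_of_contDiffOn _ _ _ ?_
    rintro _ _ ⟨x, rfl⟩ ⟨y, rfl⟩
    have key := contMDiffOn_iff_contDiffOn.1 <| contMDiffOn_of_mem_contDiffGroupoid
      (IsManifold.compatible_of_mem_maximalAtlas (hφ x x.2) (hφ y y.2))
    simp only [modelWithCornersSelf_coe, modelWithCornersSelf_coe_symm, Function.id_comp,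
      Function.comp_id, Set.range_id, Set.inter_univ, Set.preimage_id] at key ⊢
    -- A transition map of the slice is the ambient one restricted to `E × {0}` and projected back
    -- to `E`.
    have hK : ContDiff 𝕜 n fun v : E => K (v, 0) := K.contDiff.comp (by fun_prop)
    have hK' : ContDiff 𝕜 n fun w : E' => (K.symm w).1 := contDiff_fst.comp K.symm.contDiff
    refine (hK'.comp_contDiffOn (key.comp hK.contDiffOn ?_)).congr fun v _ => rfl
    intro v hv
    refine ⟨(h x x.2).target_eq ▸ Set.mem_univ _, hv.2⟩
  refine ⟨cs, hM, ?_, Topology.IsEmbedding.subtypeVal⟩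
  refine IsImmersionOfComplement.isImmersion (F := F) fun x => ?_
  -- In a slice chart and its induced chart the inclusion reads `v ↦ K (v, 0)`, the normal form of
  -- an immersion.
  refine IsImmersionAtOfComplement.mk_of_charts K (h x x.2).chart (φ x x.2) (hx x x.2) (hx x x.2)
    (IsManifold.subset_maximalAtlas (Set.mem_range_self x)) (hφ x x.2) (fun _ hy => hy) ?_
  intro v _
  exact (h x x.2).apply_symm _

end Slice

end Manifold

noncomputable section

namespace QubitRegister

open Manifold

/-! ### The topology of the space of pure states -/

section PureState

variable {n : ℕ}

theorem PureState.mk_eq_mk_iff {ψ φ : UnitVec n} :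
    PureState.mk ψ = PureState.mk φ ↔ ∃ u : Circle, (ψ : Register n) = (u : ℂ) • (φ : Register n) :=
  Quotient.eq (r := phaseSetoid n)

/-- Proportional unit vectors describe the same state. -/
theorem PureState.mk_eq_mk_of_smul {ψ φ : UnitVec n} {a : ℂ}
    (h : (ψ : Register n) = a • (φ : Register n)) : PureState.mk ψ = PureState.mk φ := by
  have ha : ‖a‖ = 1 := by
    have := congrArg norm h
    rw [norm_smul, norm_eq_of_mem_sphere, norm_eq_of_mem_sphere] at this
    simpa using this.symm
  exact PureState.mk_eq_mk_iff.2 ⟨⟨a, mem_sphere_zero_iff_norm.2 ha⟩, h⟩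

theorem PureState.mk_surjective : Function.Surjective (PureState.mk (n := n)) :=
  Quotient.mk_surjective

theorem PureState.continuous_mk : Continuous (PureState.mk (n := n)) :=
  continuous_quotient_mk'

theorem PureState.isQuotientMap_mk : Topology.IsQuotientMap (PureState.mk (n := n)) :=
  isQuotientMap_quotient_mk'

instance : CompactSpace (PureState n) :=
  inferInstanceAs (CompactSpace (Quotient (phaseSetoid n)))

/-- The matrix `ψ_b conj(ψ_c)` of the rank one projection onto a state. -/
def PureState.density : PureState n → (Fin n → Fin 2) → (Fin n → Fin 2) → ℂ :=
  Quotient.lift (fun ψ : UnitVec n => fun b c => ψ.1 b * star (ψ.1 c)) (by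
    rintro ψ φ ⟨u, h⟩
    ext b c
    have hu : (u : ℂ) * star (u : ℂ) = 1 := by
      rw [Complex.star_def, Complex.mul_conj, Circle.normSq_coe, Complex.ofReal_one]
    rw [h]
    simp only [PiLp.smul_apply, smul_eq_mul, star_mul]
    linear_combination (φ.1 b * star (φ.1 c)) * hu)

theorem PureState.continuous_density : Continuous (PureState.density (n := n)) := by
  refine PureState.isQuotientMap_mk.continuous_iff.2 ?_
  change Continuous fun ψ : UnitVec n => fun b c => ψ.1 b * star (ψ.1 c)
  fun_prop

/-- A column `c` with `ψ_c ≠ 0` is a nonzero multiple of `ψ`, so the matrix determines `ψ` up to a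
scalar, which is a phase between unit vectors. -/
theorem PureState.density_injective : Function.Injective (PureState.density (n := n)) := by
  intro p q h
  obtain ⟨ψ, rfl⟩ := PureState.mk_surjective p
  obtain ⟨φ, rfl⟩ := PureState.mk_surjective q
  obtain ⟨c, hc⟩ : ∃ c, ψ.1 c ≠ 0 := by
    by_contra! h0
    exact ne_zero_of_mem_unit_sphere ψ (by ext c; exact h0 c)
  have hc' : star (ψ.1 c) ≠ 0 := star_ne_zero.2 hc
  refine PureState.mk_eq_mk_of_smul (a := star (φ.1 c) / star (ψ.1 c)) ?_
  ext b
  have hb : ψ.1 b * star (ψ.1 c) = φ.1 b * star (φ.1 c) := congrFun (congrFun h b) c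
  rw [PiLp.smul_apply, smul_eq_mul, div_mul_eq_mul_div, eq_div_iff hc', hb, mul_comm]

instance : T2Space (PureState n) :=
  .of_injective_continuous PureState.density_injective PureState.continuous_density

/-! ### Pure states as points of the complex projective space -/

/-- The state described by the normalization of a nonzero vector. -/
def normalize (v : {v : EuclideanSpace ℂ (Fin (2 ^ n - 1 + 1)) // v ≠ 0}) : UnitVec n :=
  ⟨(amplitudes n).symm ((‖v.1‖⁻¹ : ℂ) • v.1), by
    rw [mem_sphere_zero_iff_norm, LinearIsometryEquiv.norm_map, norm_smul, norm_inv,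
      Complex.norm_real, norm_norm, inv_mul_cancel₀ (norm_ne_zero_iff.2 v.2)]⟩

theorem continuous_normalize : Continuous (normalize (n := n)) := by
  have h : Continuous fun v : {v : EuclideanSpace ℂ (Fin (2 ^ n - 1 + 1)) // v ≠ 0} =>
      (‖v.1‖⁻¹ : ℂ) := by
    refine Continuous.inv₀ (by fun_prop) fun v => ?_
    exact_mod_cast norm_ne_zero_iff.2 v.2
  exact Continuous.subtype_mk ((amplitudes n).symm.continuous.comp
    (h.smul continuous_subtype_val)) _

theorem toCP_eq_of_mk_eq {ψ φ : UnitVec n} (h : PureState.mk ψ = PureState.mk φ) :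
    toCP ψ = toCP φ := by
  obtain ⟨u, hu⟩ := PureState.mk_eq_mk_iff.1 h
  refine (Projectivization.mk_eq_mk_iff' ℂ _ _ _ _).2 ⟨u, ?_⟩
  rw [hu, map_smul]

theorem mk_eq_of_toCP_eq {ψ φ : UnitVec n} (h : toCP ψ = toCP φ) :
    PureState.mk ψ = PureState.mk φ := by
  obtain ⟨a, ha⟩ := (Projectivization.mk_eq_mk_iff' ℂ _ _ _ _).1 h
  refine PureState.mk_eq_mk_of_smul (a := a) ((amplitudes n).injective ?_)
  rw [map_smul, ha]

theorem toCP_normalize (v : {v : EuclideanSpace ℂ (Fin (2 ^ n - 1 + 1)) // v ≠ 0}) :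
    toCP (normalize v) = Projectivization.mk' ℂ v := by
  refine (Projectivization.mk_eq_mk_iff' ℂ _ _ _ _).2 ⟨(‖v.1‖⁻¹ : ℂ), ?_⟩
  simp [normalize]

theorem continuous_toCP : Continuous (toCP (n := n)) :=
  CP.isOpenQuotientMap_mk'.continuous.comp
    (Continuous.subtype_mk ((amplitudes n).continuous.comp continuous_subtype_val)
      amplitudes_ne_zero)

/-- The pure states are the points of `ℂP^(2^n - 1)`. -/
def pureStateHomeomorph (n : ℕ) : PureState n ≃ₜ CP (2 ^ n - 1) where
  toFun := Quotient.lift toCP fun _ _ h => toCP_eq_of_mk_eq (Quotient.sound h)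
  -- Since `toCP` separates states, `toCP_normalize` yields both independence of the representative
  -- and the left inverse law.
  invFun := Quotient.lift (fun v => PureState.mk (normalize v)) fun v w h =>
    mk_eq_of_toCP_eq (by rw [toCP_normalize, toCP_normalize]; exact Quotient.sound h)
  left_inv p := by
    obtain ⟨ψ, rfl⟩ := PureState.mk_surjective p
    exact mk_eq_of_toCP_eq (toCP_normalize _)
  right_inv p := by
    obtain ⟨v, rfl⟩ := CP.isOpenQuotientMap_mk'.surjective p
    exact toCP_normalize v
  continuous_toFun := PureState.isQuotientMap_mk.continuous_iff.2 continuous_toCP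
  continuous_invFun := CP.isOpenQuotientMap_mk'.isQuotientMap.continuous_iff.2
    (PureState.continuous_mk.comp continuous_normalize)

end PureState

/-! ### Product vectors -/

section ProductVector

variable {n : ℕ}

/-- The sum over bit strings of products of squared moduli factors into a product of sums over
single bits. -/
theorem norm_tensorVec (c : Fin n → Qubit) : ‖tensorVec c‖ = ∏ i, ‖c i‖ := by
  have h : ‖tensorVec c‖ ^ 2 = (∏ i, ‖c i‖) ^ 2 := by
    rw [EuclideanSpace.norm_sq_eq, ← Finset.prod_pow]
    simp only [EuclideanSpace.norm_sq_eq, tensorVec_apply, norm_prod, ← Finset.prod_pow]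
    rw [Finset.prod_univ_sum, Fintype.piFinset_univ]
  exact (pow_left_inj₀ (norm_nonneg _) (Finset.prod_nonneg fun _ _ => norm_nonneg _)
    two_ne_zero).1 h

theorem tensorVec_smul (a : Fin n → ℂ) (c : Fin n → Qubit) :
    tensorVec (fun i => a i • c i) = (∏ i, a i) • tensorVec c := by
  ext b
  simp [tensorVec_apply, Finset.prod_mul_distrib]

/-- A state is a product state as soon as one of its vectors is proportional to a product. -/
theorem mk_mem_productStates_of_smul {ψ : UnitVec n} {a : ℂ} {c : Fin n → Qubit}
    (h : (ψ : Register n) = a • tensorVec c) : PureState.mk ψ ∈ productStates n := by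
  have hψ : (ψ : Register n) ≠ 0 := ne_zero_of_mem_unit_sphere ψ
  have hc : ∀ i, ‖c i‖ ≠ 0 := by
    have : ‖tensorVec c‖ ≠ 0 := fun h0 => hψ (by rw [h, norm_eq_zero.1 h0, smul_zero])
    rw [norm_tensorVec] at this
    exact fun i => Finset.prod_ne_zero_iff.1 this i (Finset.mem_univ i)
  -- The norms of the factors are moved into the scalar, which becomes a phase since both vectors
  -- are then unit vectors.
  set d : Fin n → Qubit := fun i => (‖c i‖⁻¹ : ℂ) • c i with hd
  have hd1 : ∀ i, ‖d i‖ = 1 := fun i => by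
    rw [hd, norm_smul, norm_inv, Complex.norm_real, norm_norm, inv_mul_cancel₀ (hc i)]
  have hdt : tensorVec c = (∏ i, (‖c i‖ : ℂ)) • tensorVec d := by
    rw [← tensorVec_smul]
    congr 1
    ext1 i
    rw [hd, smul_smul, mul_inv_cancel₀ (by exact_mod_cast hc i), one_smul]
  refine ⟨d, ⟨tensorVec d, ?_⟩, hd1, rfl, PureState.mk_eq_mk_of_smul
    (a := a * ∏ i, (‖c i‖ : ℂ)) ?_⟩
  · rw [mem_sphere_zero_iff_norm, norm_tensorVec]
    exact Finset.prod_eq_one fun i _ => hd1 i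
  · rw [h, hdt, smul_smul]

/-- The bit string `b` with the `i`-th bit flipped. -/
def flipBit (b : Fin n → Fin 2) (i : Fin n) : Fin n → Fin 2 := Function.update b i (b i + 1)

theorem flipBit_ne (b : Fin n → Fin 2) (i : Fin n) : flipBit b i ≠ b := fun h => by
  have := congrFun h i
  simp [flipBit] at this

/-- In terms of the ratios `ψ_c / ψ_b`, product states are those for which the ratio at `c` is the
product of the ratios at the bit strings that differ from `b` at one of the bits where `c` does. -/
theorem mk_mem_productStates_iff (ψ : UnitVec n) (b : Fin n → Fin 2) (hb : ψ.1 b ≠ 0) :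
    PureState.mk ψ ∈ productStates n ↔
      ∀ c, ψ.1 c / ψ.1 b = ∏ i, if c i = b i then 1 else ψ.1 (flipBit b i) / ψ.1 b := by
  have two (x y : Fin 2) (h : x ≠ y) : x = y + 1 := by omega
  constructor
  · rintro ⟨d, φ, -, hφ, h⟩ c
    obtain ⟨u, hu⟩ := PureState.mk_eq_mk_iff.1 h
    have hu0 : (u : ℂ) ≠ 0 := u.coe_ne_zero
    have hψ (c) : ψ.1 c = u * ∏ i, d i (c i) := by
      rw [hu, PiLp.smul_apply, hφ, tensorVec_apply, smul_eq_mul]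
    have hd (i) : d i (b i) ≠ 0 := by
      rw [hψ] at hb
      exact Finset.prod_ne_zero_iff.1 (right_ne_zero_of_mul hb) i (Finset.mem_univ i)
    have hdiv (c) : ψ.1 c / ψ.1 b = ∏ i, d i (c i) / d i (b i) := by
      rw [hψ, hψ, mul_div_mul_left _ _ hu0, Finset.prod_div_distrib]
    rw [hdiv]
    refine Finset.prod_congr rfl fun i _ => ?_
    split_ifs with hi
    · rw [hi, div_self (hd i)]
    -- At the flip of bit `i` only the `i`-th factor differs from 1.
    · rw [hdiv, Finset.prod_eq_single i]
      · simp [flipBit, two _ _ hi]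
      · intro j _ hj
        simp [flipBit, hj, hd j]
      · simp
  · intro h
    -- Each factor is normalized to have entry 1 at `b i`; its other entry is the ratio at the flip
    -- of bit `i`.
    refine mk_mem_productStates_of_smul (a := ψ.1 b) (c := fun i => WithLp.toLp 2 fun x =>
      if x = b i then 1 else ψ.1 (flipBit b i) / ψ.1 b) ?_
    ext c
    rw [PiLp.smul_apply, tensorVec_apply, smul_eq_mul, ← h c, mul_div_cancel₀ _ hb]

end ProductVector

end QubitRegister

end

/-- A smooth section `Q` of a linear map `P` is straightened by a diffeomorphism: its image becomes
a coordinate subspace. -/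
theorem exists_homeomorph_snd_eq_zero_iff {A E F : Type*}
    [NormedAddCommGroup A] [NormedSpace ℝ A] [FiniteDimensional ℝ A]
    [NormedAddCommGroup E] [NormedSpace ℝ E] [FiniteDimensional ℝ E]
    [NormedAddCommGroup F] [NormedSpace ℝ F] [FiniteDimensional ℝ F] {n : WithTop ℕ∞}
    (P : A →L[ℝ] E) (Q : E → A) (hQ : ContDiff ℝ n Q) (hPQ : ∀ t, P (Q t) = t)
    (hdim : Module.finrank ℝ A = Module.finrank ℝ E + Module.finrank ℝ F) :
    ∃ D : A ≃ₜ E × F, ContDiff ℝ n D ∧ ContDiff ℝ n D.symm ∧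
      ∀ w, (D w).2 = 0 ↔ Q (P w) = w := by
  -- The section `Q` makes `P` surjective, so `A` splits linearly as `E × ker P`, and the dimension
  -- count identifies `ker P` with `F`.
  obtain ⟨J, hJ⟩ := (P : A →ₗ[ℝ] E).exists_rightInverse_of_surjective
    (LinearMap.range_eq_top.2 fun t => ⟨Q t, hPQ t⟩)
  let J' : E →L[ℝ] A := J.toContinuousLinearMap
  have hJ' : Function.RightInverse J' P := fun t => LinearMap.congr_fun hJ t
  let Λ₀ := ContinuousLinearEquiv.equivOfRightInverse P J' hJ'
  have hker : Module.finrank ℝ (LinearMap.ker (P : A →ₗ[ℝ] E)) = Module.finrank ℝ F := by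
    have := Λ₀.toLinearEquiv.finrank_eq
    rw [Module.finrank_prod] at this
    omega
  let Λ : A ≃L[ℝ] E × F := Λ₀.trans
    ((ContinuousLinearEquiv.refl ℝ E).prodCongr (ContinuousLinearEquiv.ofFinrankEq hker))
  have hΛ (w) : (Λ w).1 = P w := rfl
  -- Because `P ∘ Q = id`, the image of `Q` in the coordinates `Λ` is the graph of `q`; subtracting
  -- `q` flattens it.
  let q : E → F := fun t => (Λ (Q t)).2
  have hq : ContDiff ℝ n q := contDiff_snd.comp (Λ.contDiff.comp hQ)
  have h1 : ContDiff ℝ n fun x : E × F => (x.1, x.2 - q x.1) :=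
    contDiff_fst.prodMk (contDiff_snd.sub (hq.comp contDiff_fst))
  have h2 : ContDiff ℝ n fun x : E × F => (x.1, x.2 + q x.1) :=
    contDiff_fst.prodMk (contDiff_snd.add (hq.comp contDiff_fst))
  let s : E × F ≃ₜ E × F :=
    { toFun := fun x => (x.1, x.2 - q x.1)
      invFun := fun x => (x.1, x.2 + q x.1)
      left_inv := fun x => by simp
      right_inv := fun x => by simp
      continuous_toFun := h1.continuous
      continuous_invFun := h2.continuous }
  refine ⟨Λ.toHomeomorph.trans s, h1.comp Λ.contDiff, Λ.symm.contDiff.comp h2, fun w => ?_⟩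
  change (Λ w).2 - (Λ (Q (Λ w).1)).2 = 0 ↔ _
  rw [hΛ, sub_eq_zero, ← Λ.injective.eq_iff, Prod.ext_iff, hΛ, hΛ, hPQ]
  simp [eq_comm]

noncomputable section

namespace QubitRegister

open Manifold

theorem finrank_real_euclideanSpace_complex (m : ℕ) :
    Module.finrank ℝ (EuclideanSpace ℂ (Fin m)) = 2 * m := by
  rw [(WithLp.linearEquiv 2 ℝ (Fin m → ℂ)).finrank_eq, Module.finrank_pi_fintype]
  simp [mul_comm]

/-! ### The Segre parametrization in affine charts -/

section Segre

variable {n : ℕ}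

/-- The ratios `ψ_c / ψ_b` of a product vector as functions of its ratios at the bit strings that
differ from `b` in one bit. -/
def segre (i : Fin (2 ^ n - 1 + 1)) (t : EuclideanSpace ℂ (Fin n)) :
    EuclideanSpace ℂ (Fin (2 ^ n - 1)) :=
  WithLp.toLp 2 fun k => ∏ j,
    if (basisEnum n).symm (i.succAbove k) j = (basisEnum n).symm i j then 1 else t j

theorem contDiff_segre (i : Fin (2 ^ n - 1 + 1)) : ContDiff ℝ ∞ (segre (n := n) i) := by
  refine (contDiff_piLp 2).2 fun k => ?_
  refine contDiff_prod (t := Finset.univ) (f := fun j (t : EuclideanSpace ℂ (Fin n)) =>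
    if (basisEnum n).symm (i.succAbove k) j = (basisEnum n).symm i j then (1 : ℂ) else t j)
    fun j _ => ?_
  split_ifs <;> fun_prop

theorem exists_succAbove_eq_flipBit (i : Fin (2 ^ n - 1 + 1)) (j : Fin n) :
    ∃ k, i.succAbove k = basisEnum n (flipBit ((basisEnum n).symm i) j) := by
  refine Fin.exists_succAbove_eq fun h => flipBit_ne ((basisEnum n).symm i) j ?_
  rw [Equiv.eq_symm_apply, h]

/-- The position, among the affine coordinates, of the bit string with the `j`-th bit flipped. -/
def flipIndex (i : Fin (2 ^ n - 1 + 1)) (j : Fin n) : Fin (2 ^ n - 1) :=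
  (exists_succAbove_eq_flipBit i j).choose

theorem symm_succAbove_flipIndex (i : Fin (2 ^ n - 1 + 1)) (j : Fin n) :
    (basisEnum n).symm (i.succAbove (flipIndex i j)) = flipBit ((basisEnum n).symm i) j := by
  rw [flipIndex, (exists_succAbove_eq_flipBit i j).choose_spec, Equiv.symm_apply_apply]

/-- The affine coordinates at the bit strings that differ from a given one in one bit. -/
def flipCoords (i : Fin (2 ^ n - 1 + 1)) :
    EuclideanSpace ℂ (Fin (2 ^ n - 1)) →L[ℝ] EuclideanSpace ℂ (Fin n) :=
  LinearMap.toContinuousLinearMap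
    { toFun := fun w => WithLp.toLp 2 fun j => w (flipIndex i j)
      map_add' := fun _ _ => rfl
      map_smul' := fun _ _ => rfl }

@[simp]
theorem flipCoords_apply (i : Fin (2 ^ n - 1 + 1)) (w : EuclideanSpace ℂ (Fin (2 ^ n - 1)))
    (j : Fin n) : flipCoords i w j = w (flipIndex i j) := rfl

/-- At a string with only bit `j` flipped, the product reduces to its `j`-th factor. This is the
section property needed for straightening. -/
theorem flipCoords_segre (i : Fin (2 ^ n - 1 + 1)) (t : EuclideanSpace ℂ (Fin n)) :
    flipCoords i (segre i t) = t := by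
  ext j
  simp only [flipCoords_apply, segre, symm_succAbove_flipIndex]
  rw [Finset.prod_eq_single j]
  · simp [flipBit]
  · intro l _ hl
    simp [flipBit, hl]
  · simp

/-- In an affine chart, the product states are the image of `segre`. -/
theorem mem_productStates_iff_segre (i : Fin (2 ^ n - 1 + 1)) (p : PureState n)
    (hp : pureStateHomeomorph n p ∈ CP.affineSource i) :
    p ∈ productStates n ↔
      segre i (flipCoords i (CP.affineChart i (pureStateHomeomorph n p))) =
        CP.affineChart i (pureStateHomeomorph n p) := by
  obtain ⟨ψ, rfl⟩ := PureState.mk_surjective p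
  have hb : ψ.1 ((basisEnum n).symm i) ≠ 0 := hp
  have hw (k) : CP.affineChart i (pureStateHomeomorph n (PureState.mk ψ)) k =
      ψ.1 ((basisEnum n).symm (i.succAbove k)) / ψ.1 ((basisEnum n).symm i) := rfl
  have hs (k) : segre i (flipCoords i (CP.affineChart i (pureStateHomeomorph n (PureState.mk ψ)))) k
      = ∏ j, if (basisEnum n).symm (i.succAbove k) j = (basisEnum n).symm i j then 1 else
        ψ.1 (flipBit ((basisEnum n).symm i) j) / ψ.1 ((basisEnum n).symm i) := by
    simp only [segre, flipCoords_apply, hw, symm_succAbove_flipIndex]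
  rw [mk_mem_productStates_iff ψ _ hb, PiLp.ext_iff]
  simp only [hw, hs]
  constructor
  · exact fun h k => (h _).symm
  · intro h c
    -- The affine coordinates omit the index `i`; there both sides of the criterion equal 1.
    obtain ⟨l, rfl⟩ := (basisEnum n).symm.surjective c
    rcases Fin.eq_self_or_eq_succAbove i l with rfl | ⟨k, rfl⟩
    · simp [hb]
    · exact (h k).symm

end Segre

end QubitRegister

end

open QubitRegister in
/-- The pure states of an `n`-qubit register, with the quotient topology, form a second countable
Hausdorff space that has the structure of a smooth real manifold of dimension `2^(n+1) - 2` for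
which the canonical map to complex projective space `ℂP^(2^n - 1)` is a diffeomorphism; in this
manifold the product states form a smoothly embedded manifold of dimension `2n`. -/
theorem mainTheorem4 (n : ℕ) :
    T2Space (PureState n) ∧ SecondCountableTopology (PureState n) ∧
    ∃ _ : ChartedSpace (EuclideanSpace ℝ (Fin (2 ^ (n + 1) - 2))) (PureState n),
      IsManifold (𝓡 (2 ^ (n + 1) - 2)) ∞ (PureState n) ∧
      (∃ Φ : Diffeomorph (𝓡 (2 ^ (n + 1) - 2)) 𝓘(ℝ, EuclideanSpace ℂ (Fin (2 ^ n - 1)))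
          (PureState n) (CP (2 ^ n - 1)) ∞,
        ∀ ψ : UnitVec n, Φ (PureState.mk ψ) = toCP ψ) ∧
      ∃ _ : ChartedSpace (EuclideanSpace ℝ (Fin (2 * n))) (productStates n),
        IsManifold (𝓡 (2 * n)) ∞ (productStates n) ∧
        Manifold.IsSmoothEmbedding (𝓡 (2 * n)) (𝓡 (2 ^ (n + 1) - 2)) ∞
          (Subtype.val : productStates n → PureState n) := by
  -- This gives `2 * n ≤ 2 ^ (n + 1) - 2`, so the truncated subtraction in the codimension is exact.
  have hlt : n < 2 ^ n := Nat.lt_two_pow_self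
  have hpow : 2 ^ (n + 1) = 2 * 2 ^ n := pow_succ' 2 n
  let L : EuclideanSpace ℂ (Fin (2 ^ n - 1)) ≃L[ℝ] EuclideanSpace ℝ (Fin (2 ^ (n + 1) - 2)) :=
    ContinuousLinearEquiv.ofFinrankEq (by
      rw [finrank_real_euclideanSpace_complex, finrank_euclideanSpace_fin]; omega)
  let T : EuclideanSpace ℂ (Fin n) ≃L[ℝ] EuclideanSpace ℝ (Fin (2 * n)) :=
    ContinuousLinearEquiv.ofFinrankEq (by
      rw [finrank_real_euclideanSpace_complex, finrank_euclideanSpace_fin])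
  let K : (EuclideanSpace ℝ (Fin (2 * n)) × EuclideanSpace ℝ (Fin (2 ^ (n + 1) - 2 - 2 * n)))
      ≃L[ℝ] EuclideanSpace ℝ (Fin (2 ^ (n + 1) - 2)) :=
    ContinuousLinearEquiv.ofFinrankEq (by
      rw [Module.finrank_prod]; simp only [finrank_euclideanSpace_fin]; omega)
  let h := pureStateHomeomorph n
  let := Manifold.transportChartedSpace h L.toHomeomorph
  have hM : IsManifold (𝓡 (2 ^ (n + 1) - 2)) ∞ (PureState n) :=
    Manifold.isManifold_transportChartedSpace h L
  -- The space is compact as a quotient of a sphere, hence σ-compact.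
  refine ⟨inferInstance, ChartedSpace.secondCountable_of_sigmaCompact
    (EuclideanSpace ℝ (Fin (2 ^ (n + 1) - 2))) _, this, hM,
    ⟨⟨h.toEquiv, Manifold.contMDiff_transportChartedSpace h L,
      Manifold.contMDiff_symm_transportChartedSpace h L⟩, fun ψ => rfl⟩,
    Manifold.exists_chartedSpace_of_isSliceChart K _ fun p _ => ?_⟩
  obtain ⟨i, hi⟩ := CP.exists_mem_affineSource (h p)
  obtain ⟨D, hD, hD', hD0⟩ := exists_homeomorph_snd_eq_zero_iff
    (F := EuclideanSpace ℝ (Fin (2 ^ (n + 1) - 2 - 2 * n)))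
    ((T : _ →L[ℝ] _).comp (flipCoords i)) (segre i ∘ T.symm)
    ((contDiff_segre i).comp T.symm.contDiff)
    (fun t => by simp [flipCoords_segre])
    (by rw [finrank_real_euclideanSpace_complex]; simp only [finrank_euclideanSpace_fin]; omega)
  -- The straightening `D` followed by `K` takes the place of `L`; being a smooth diffeomorphism, it
  -- still gives a chart of the maximal atlas.
  refine ⟨Manifold.transportChart h (D.trans K.toHomeomorph) (CP.affineChart i),
    Manifold.transportChart_mem_maximalAtlas h L
      (IsManifold.subset_maximalAtlas (Set.mem_range_self i)) _ (K.contDiff.comp hD)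
      (hD'.comp K.symm.contDiff), ?_, ?_, fun y hy => ?_⟩
  · rw [Manifold.transportChart_source]
    exact hi
  · rw [Manifold.transportChart_target]
    exact Set.preimage_univ
  · rw [Manifold.transportChart_source] at hy
    rw [mem_productStates_iff_segre i y hy, Manifold.transportChart_apply]
    change _ ↔ (K.symm (K (D _))).2 = 0
    rw [K.symm_apply_apply, hD0]
    simp [h]
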